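/- There is a universal constant $C > 0$ with the following property. Let $\Gamma$ be a symmetric real random variable with $\mathbb{E}\,\Gamma^6 < \infty$ such that the (real-valued, even) function $\gamma(\xi) = \mathbb{E} \exp(-i\xi\Gamma)$ satisfies $\gamma(\xi) = 0$ for $|\xi| \ge 1$ and $1 - 1000\,\xi^2 \le \gamma(\xi) \le 1$ for all $\xi \in \mathbb{R}$. Let $\Delta_1, \ldots, \Delta_n$ be independent symmetric Bernoulli random variables, i.e. $\mathbb{P}(\Delta_i = 1) = \mathbb{P}(\Delta_i = -1) = 1/2$, and suppose that $\Gamma$ is independent of $(\Delta_1, \ldots, \Delta_n)$. Let $0 \ne \theta = (\theta_1, \ldots, \theta_n) \in \mathbb{R}^n$ and $\sigma > 0$ satisfy $$ \sum_{i\,;\, |\theta_i| \ge \sigma} \theta_i^2 \le \frac12 |\theta|^2, $$ where $|\cdot|$ is the Euclidean norm. Then, for every $t \in \mathbb{R}$, $$ \left| \mathbb{P}\left( \sigma \Gamma + \sum_{i=1}^n \theta_i \Delta_i \ge t \right) - \Phi\left( \frac{t}{|\theta|} \right) \right| \le C \left( \frac{\sigma^2}{|\theta|^2} + \sum_{i=1}^n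 \frac{\theta_i^4}{|\theta|^4} \right), $$ where $\Phi(t) = \frac{1}{\sqrt{2\pi}} \int_t^\infty e^{-s^2/2}\, ds$. -/

import Mathlib

open MeasureTheory ProbabilityTheory

/-- The standard Gaussian density `φ(s) = (2π)^{-1/2} exp(-s²/2)`. -/
noncomputable def gaussDensity (s : ℝ) : ℝ :=
  1 / Real.sqrt (2 * Real.pi) * Real.exp (-s ^ 2 / 2)

/-- The upper tail `Φ(t) = ∫_t^∞ φ(s) ds` of the standard Gaussian law. -/
noncomputable def gaussTail (t : ℝ) : ℝ :=
  ∫ s in Set.Ioi t, gaussDensity s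

/-- The function `γ(ξ) = 𝔼 exp(-i ξ Γ)`. -/
noncomputable def fourierOf {Ω : Type*} [MeasurableSpace Ω] (P : Measure Ω)
    (Γ : Ω → ℝ) (ξ : ℝ) : ℂ :=
  ∫ ω, Complex.exp (-(Complex.I * (ξ : ℂ) * (Γ ω : ℂ))) ∂P

/-- `Γ` is an admissible smoothing variable. As `Γ` is symmetric, `γ` is real-valued, so the
two-sided bound on `γ` is expressed through its real part. -/
structure IsSmoothingVariable {Ω : Type*} [MeasurableSpace Ω] (P : Measure Ω)
    (Γ : Ω → ℝ) : Prop where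
  measurable : Measurable Γ
  symmetric : IdentDistrib Γ (fun ω => -Γ ω) P P
  integrable_pow_six : Integrable (fun ω => Γ ω ^ 6) P
  fourier_eq_zero : ∀ ξ : ℝ, 1 ≤ |ξ| → fourierOf P Γ ξ = 0
  le_fourier : ∀ ξ : ℝ, 1 - 1000 * ξ ^ 2 ≤ (fourierOf P Γ ξ).re
  fourier_le : ∀ ξ : ℝ, (fourierOf P Γ ξ).re ≤ 1

/-- `Δ` is a symmetric Bernoulli (Rademacher) variable. -/
structure IsSymmetricBernoulli {Ω : Type*} [MeasurableSpace Ω] (P : Measure Ω)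
    (Δ : Ω → ℝ) : Prop where
  measurable : Measurable Δ
  prob_one : P {ω | Δ ω = 1} = 1 / 2
  prob_neg_one : P {ω | Δ ω = -1} = 1 / 2

/-! Scale to `|θ| = 1`. By Fourier inversion of the difference of tails
(`abs_measureReal_Ici_sub_le`), the error is at most `(2π)⁻¹` times the `L¹` norm of the
characteristic function difference divided by `ξ`.

The smoothed sum has characteristic function `γ(sξ) ∏ cos(a i ξ)`, compared with `exp(-ξ²/2)` in
`abs_mul_prod_cos_sub_exp_le`. If `s|ξ| ≥ 1` the first vanishes and the Gaussian is absorbed using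
`1 ≤ s²ξ²`. If `s|ξ| < 1`, the coordinates below `s` carry half the variance and give decay
`exp(-ξ²/8)`; replacing `γ` by `1` costs `O(s²ξ²)`, and replacing each cosine by a Gaussian factor
costs `O((a i ξ)⁴)`. Both costs remain integrable after division by `|ξ|`. -/

/-! ### Fourier inversion for tail functions. -/

/-- The signed kernel `1_{x ≤ y} - 1_{x ≤ 0}`, written through half-open intervals. -/
noncomputable def stepKernel (y x : ℝ) : ℂ :=
  (Set.Ioc 0 y).indicator (fun _ => 1) x - (Set.Ioc y 0).indicator (fun _ => 1) x

lemma measurable_uncurry_stepKernel : Measurable (Function.uncurry stepKernel) := by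
  have h1 : MeasurableSet {p : ℝ × ℝ | p.2 ∈ Set.Ioc 0 p.1} :=
    (measurableSet_lt measurable_const measurable_snd).inter
      (measurableSet_le measurable_snd measurable_fst)
  have h2 : MeasurableSet {p : ℝ × ℝ | p.2 ∈ Set.Ioc p.1 0} :=
    (measurableSet_lt measurable_fst measurable_snd).inter
      (measurableSet_le measurable_snd measurable_const)
  exact ((measurable_const (a := (1 : ℂ))).indicator h1).sub
    ((measurable_const (a := (1 : ℂ))).indicator h2)

lemma integral_mul_stepKernel {f : ℝ → ℂ} (hf : Continuous f) (y : ℝ) :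
    Integrable (fun x => f x * stepKernel y x) ∧
      ∫ x, f x * stepKernel y x = ∫ x in (0 : ℝ)..y, f x := by
  have h1 : Integrable ((Set.Ioc 0 y).indicator f) :=
    (integrable_indicator_iff measurableSet_Ioc).2 (hf.integrableOn_Ioc)
  have h2 : Integrable ((Set.Ioc y 0).indicator f) :=
    (integrable_indicator_iff measurableSet_Ioc).2 (hf.integrableOn_Ioc)
  have h : (fun x => f x * stepKernel y x) =
      fun x => (Set.Ioc 0 y).indicator f x - (Set.Ioc y 0).indicator f x := by
    ext x
    simp only [stepKernel, mul_sub, Set.indicator_apply, mul_ite, mul_one, mul_zero]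
  rw [h]
  refine ⟨h1.sub h2, ?_⟩
  rw [integral_sub h1 h2, integral_indicator measurableSet_Ioc,
    integral_indicator measurableSet_Ioc, intervalIntegral]

lemma integral_norm_stepKernel (y : ℝ) : ∫ x, ‖stepKernel y x‖ = |y| := by
  rcases le_total 0 y with h | h
  · have : (fun x => ‖stepKernel y x‖) = (Set.Ioc 0 y).indicator (fun _ => (1 : ℝ)) := by
      ext x
      by_cases hx : x ∈ Set.Ioc 0 y <;> simp [stepKernel, hx, Set.Ioc_eq_empty_of_le h]
    rw [this, integral_indicator measurableSet_Ioc]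
    simp [h, abs_of_nonneg h]
  · have : (fun x => ‖stepKernel y x‖) = (Set.Ioc y 0).indicator (fun _ => (1 : ℝ)) := by
      ext x
      by_cases hx : x ∈ Set.Ioc y 0 <;> simp [stepKernel, hx, Set.Ioc_eq_empty_of_le h]
    rw [this, integral_indicator measurableSet_Ioc]
    simp [h, abs_of_nonpos h]

lemma integrable_uncurry_stepKernel {μ : Measure ℝ} [IsProbabilityMeasure μ]
    (hμ : Integrable (fun y => y) μ) :
    Integrable (Function.uncurry stepKernel) (μ.prod volume) := by
  rw [integrable_prod_iff measurable_uncurry_stepKernel.aestronglyMeasurable]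
  refine ⟨.of_forall fun y => ?_, ?_⟩
  · simpa using (integral_mul_stepKernel (f := fun _ => 1) continuous_const y).1
  · simpa [Function.uncurry, integral_norm_stepKernel] using hμ.abs

/-- Subtracting the tail of `δ₀` makes the tail of `μ` integrable on the whole line; the correction
cancels when two laws are compared. -/
lemma integral_stepKernel {μ : Measure ℝ} [IsProbabilityMeasure μ] (x : ℝ) :
    ∫ y, stepKernel y x ∂μ = (μ.real (Set.Ici x) : ℂ) - if x ≤ 0 then 1 else 0 := by
  have h : (fun y => stepKernel y x) =
      fun y => (Set.Ici x).indicator (fun _ => (1 : ℂ)) y - if x ≤ 0 then 1 else 0 := by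
    ext y
    simp only [stepKernel, Set.indicator_apply, Set.mem_Ioc, Set.mem_Ici]
    grind
  rw [h, integral_sub ((integrable_const _).indicator measurableSet_Ici) (integrable_const _),
    integral_indicator measurableSet_Ici]
  simp

/-- The Fourier transform of the tail function of `μ`, normalised by the tail of `δ₀`. -/
lemma fourier_integral_stepKernel {μ : Measure ℝ} [IsProbabilityMeasure μ]
    (hμ : Integrable (fun y => y) μ) {w : ℝ} (hw : w ≠ 0) :
    FourierTransform.fourier (fun x => ∫ y, stepKernel y x ∂μ) w =
      (charFun μ (-(2 * Real.pi * w)) - 1) / (-(2 * Real.pi * w * Complex.I)) := by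
  have hc : (-(2 * Real.pi * w * Complex.I) : ℂ) ≠ 0 := by
    simp [hw, Real.pi_ne_zero]
  set c : ℂ := -(2 * Real.pi * w * Complex.I) with hcdef
  have hcont : Continuous fun x : ℝ => Complex.exp (c * x) := by fun_prop
  have hnorm (x : ℝ) : ‖Complex.exp (c * x)‖ = 1 := by
    rw [Complex.norm_exp]; simp [hcdef]
  rw [Real.fourier_real_eq_integral_exp_smul]
  have e1 (x : ℝ) : Complex.exp (↑(-2 * Real.pi * x * w) * Complex.I) •
      ∫ y, stepKernel y x ∂μ = ∫ y, Complex.exp (c * x) * stepKernel y x ∂μ := by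
    rw [integral_const_mul, smul_eq_mul]
    congr 2
    rw [hcdef]; push_cast; ring
  simp_rw [e1]
  have hint : Integrable (Function.uncurry fun y x : ℝ => Complex.exp (c * x) * stepKernel y x)
      (μ.prod volume) := by
    refine (integrable_uncurry_stepKernel hμ).norm.mono'
      (Measurable.aestronglyMeasurable ?_) (.of_forall fun p => ?_)
    · exact (hcont.measurable.comp measurable_snd).mul measurable_uncurry_stepKernel
    · simp [Function.uncurry, hnorm]
  -- After Fubini, the inner integral is `∫₀^y exp(cx) dx = (exp(cy) - 1) / c`.
  rw [← integral_integral_swap hint]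
  simp_rw [(integral_mul_stepKernel hcont _).2, integral_exp_mul_complex hc]
  rw [integral_div, integral_sub, charFun_apply_real]
  · simp only [Complex.ofReal_zero, mul_zero, Complex.exp_zero, integral_const, probReal_univ,
      one_smul]
    congr 3
    ext y
    rw [hcdef]; push_cast; congr 1; ring
  · exact Integrable.of_bound (by fun_prop) 1 (.of_forall fun y => (hnorm y).le)
  · simp

lemma tendsto_measureReal_Ici_left (μ : Measure ℝ) [IsFiniteMeasure μ] (t : ℝ) :
    Filter.Tendsto (fun x => μ.real (Set.Ici x)) (nhdsWithin t (Set.Iio t))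
      (nhds (μ.real (Set.Ici t))) := by
  have h := tendsto_measure_biInter_gt (μ := μ) (s := fun r : ℝ => Set.Ici (t - r)) (a := 0)
    (fun _ _ => measurableSet_Ici.nullMeasurableSet)
    (fun i j _ hij => Set.Ici_subset_Ici.2 (by linarith)) ⟨1, one_pos, measure_ne_top _ _⟩
  have hI : ⋂ r > (0 : ℝ), Set.Ici (t - r) = Set.Ici t := by
    ext x
    simp only [Set.mem_iInter, Set.mem_Ici]
    refine ⟨fun hx => le_of_forall_pos_le_add fun r hr => ?_, fun hx r hr => ?_⟩
    · linarith [hx r hr]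
    · linarith
  rw [hI] at h
  have h2 : Filter.Tendsto (fun x => t - x) (nhdsWithin t (Set.Iio t))
      (nhdsWithin 0 (Set.Ioi 0)) := by
    refine tendsto_nhdsWithin_iff.2 ⟨?_, ?_⟩
    · refine (Continuous.tendsto' (by fun_prop) _ _ (by simp)).mono_left nhdsWithin_le_nhds
    · filter_upwards [self_mem_nhdsWithin] with x hx
      simpa using hx
  have h3 := (ENNReal.tendsto_toReal (measure_ne_top μ (Set.Ici t))).comp (h.comp h2)
  simpa [Function.comp_def, Measure.real] using h3

lemma antitone_measureReal_Ici (μ : Measure ℝ) [IsFiniteMeasure μ] :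
    Antitone fun x => μ.real (Set.Ici x) :=
  fun _ _ h => measureReal_mono (Set.Ici_subset_Ici.2 h)

/-- Two laws on the line with finite first moment have uniformly close tails once the difference
of their characteristic functions, divided by the frequency, is small in `L¹`. -/
theorem abs_measureReal_Ici_sub_le {μ ν : Measure ℝ} [IsProbabilityMeasure μ]
    [IsProbabilityMeasure ν] (hμ : Integrable (fun y => y) μ) (hν : Integrable (fun y => y) ν)
    {k : ℝ → ℝ} (hk : Integrable k)
    (h : ∀ ξ, ‖charFun μ ξ - charFun ν ξ‖ ≤ |ξ| * k ξ) (t : ℝ) :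
    |μ.real (Set.Ici t) - ν.real (Set.Ici t)| ≤ (2 * Real.pi)⁻¹ * ∫ ξ, k ξ := by
  set G : ℝ → ℂ := fun x => (μ.real (Set.Ici x) : ℂ) - ν.real (Set.Ici x) with hG
  have hGeq : G = fun x => (∫ y, stepKernel y x ∂μ) - ∫ y, stepKernel y x ∂ν := by
    ext x; simp [hG, integral_stepKernel]
  have hIμ := (integrable_uncurry_stepKernel hμ).integral_prod_right
  have hIν := (integrable_uncurry_stepKernel hν).integral_prod_right
  have hGint : Integrable G := by rw [hGeq]; exact hIμ.sub hIν
  have hkn : Integrable fun w : ℝ => k (-(2 * Real.pi * w)) := by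
    have := hk.comp_mul_left' (R := -(2 * Real.pi)) (by simp [Real.pi_ne_zero])
    simpa [neg_mul] using this
  have hF (w : ℝ) (hw : w ≠ 0) :
      ‖FourierTransform.fourier G w‖ ≤ k (-(2 * Real.pi * w)) := by
    have e : FourierTransform.fourier G w =
        (charFun μ (-(2 * Real.pi * w)) - charFun ν (-(2 * Real.pi * w))) /
          (-(2 * Real.pi * w * Complex.I)) := by
      have : FourierTransform.fourier G w =
          FourierTransform.fourier (fun x => ∫ y, stepKernel y x ∂μ) w -
          FourierTransform.fourier (fun x => ∫ y, stepKernel y x ∂ν) w := by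
        rw [hGeq]
        simp only [Real.fourier_real_eq, smul_sub]
        exact integral_sub (by simpa [mul_comm] using (Real.fourierIntegral_convergent_iff w).2 hIμ)
          (by simpa [mul_comm] using (Real.fourierIntegral_convergent_iff w).2 hIν)
      rw [this, fourier_integral_stepKernel hμ hw, fourier_integral_stepKernel hν hw]
      ring
    have hn : ‖(-(2 * Real.pi * w * Complex.I) : ℂ)‖ = |-(2 * Real.pi * w)| := by simp [abs_mul]
    rw [e, norm_div, hn, div_le_iff₀ (by simp [hw, Real.pi_ne_zero])]
    exact (h _).trans_eq (mul_comm _ _)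
  have hne : ∀ᵐ w : ℝ, w ≠ 0 := by simp [ae_iff, measure_singleton]
  have hFint : Integrable (FourierTransform.fourier G) := by
    refine hkn.mono' ?_ (hne.mono hF)
    exact (VectorFourier.fourierIntegral_continuous Real.continuous_fourierChar
      continuous_inner hGint).aestronglyMeasurable
  have hB : ∫ w : ℝ, k (-(2 * Real.pi * w)) = (2 * Real.pi)⁻¹ * ∫ ξ, k ξ := by
    have := Measure.integral_comp_mul_left k (-(2 * Real.pi))
    simpa [neg_mul, abs_of_pos Real.pi_pos] using this
  have hcont (x : ℝ) (hx : ContinuousAt G x) :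
      |μ.real (Set.Ici x) - ν.real (Set.Ici x)| ≤ (2 * Real.pi)⁻¹ * ∫ ξ, k ξ := by
    have e := hGint.fourierInv_fourier_eq hFint hx
    have e2 : |μ.real (Set.Ici x) - ν.real (Set.Ici x)| = ‖G x‖ := by
      simp only [hG]
      rw [← Complex.ofReal_sub, Complex.norm_real, Real.norm_eq_abs]
    rw [e2, ← e, ← hB, Real.fourierInv_eq]
    refine norm_integral_le_of_norm_le hkn (hne.mono fun w hw => ?_)
    simpa using hF w hw
  -- Inversion covers only continuity points. By left continuity a violation at `t` persists on an
  -- interval to its left, which contains a continuity point of both monotone tails.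
  by_contra! hlt
  have hev := (((tendsto_measureReal_Ici_left μ t).sub
    (tendsto_measureReal_Ici_left ν t)).abs).eventually_const_lt hlt
  obtain ⟨a, ha, hsub⟩ := (mem_nhdsLT_iff_exists_Ioo_subset).1 hev
  have hcount := ((antitone_measureReal_Ici μ).countable_not_continuousAt).union
    ((antitone_measureReal_Ici ν).countable_not_continuousAt)
  obtain ⟨x, hx, hxc⟩ := (hcount.dense_compl ℝ).exists_mem_open isOpen_Ioo
    (Set.nonempty_Ioo.2 ha)
  simp only [Set.mem_compl_iff, Set.mem_union, Set.mem_ofPred_eq, not_or, not_not] at hx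
  refine absurd (hcont x ?_) (not_le.2 (hsub hxc))
  exact (Complex.continuous_ofReal.continuousAt.comp hx.1).sub
    (Complex.continuous_ofReal.continuousAt.comp hx.2)

/-! ### Cosine factors against Gaussian factors. -/

/-- Weakening `x²/2` to `x²/4` absorbs the quartic Taylor remainder. -/
lemma abs_cos_le_exp_neg_sq {x : ℝ} (hx : |x| ≤ 1) : |Real.cos x| ≤ Real.exp (-(x ^ 2 / 4)) := by
  have hx2 : x ^ 2 ≤ 1 := by rw [← sq_abs]; exact pow_le_one₀ (abs_nonneg _) hx
  have hb := abs_le.1 (Real.cos_bound hx)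
  have h4 : |x| ^ 4 = (x ^ 2) ^ 2 := by rw [← sq_abs x]; ring
  rw [h4] at hb
  rw [abs_le]
  have he := Real.add_one_le_exp (-(x ^ 2 / 4))
  constructor <;> nlinarith [sq_nonneg x, hb.1, hb.2]

lemma abs_cos_sub_exp_le (x : ℝ) : |Real.cos x - Real.exp (-(x ^ 2 / 2))| ≤ 2 * x ^ 4 := by
  rcases le_total |x| 1 with hx | hx
  · have hx2 : x ^ 2 ≤ 1 := by rw [← sq_abs]; exact pow_le_one₀ (abs_nonneg _) hx
    have hb := abs_le.1 (Real.cos_bound hx)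
    have h4 : |x| ^ 4 = (x ^ 2) ^ 2 := by rw [← sq_abs x]; ring
    rw [h4] at hb
    have he := abs_le.1 (Real.abs_exp_sub_one_sub_id_le (x := -(x ^ 2 / 2))
      (by rw [abs_neg, abs_of_nonneg (by positivity)]; linarith))
    rw [abs_le]
    constructor <;> nlinarith [sq_nonneg (x ^ 2), hb.1, hb.2, he.1, he.2]
  -- Here the trivial bound `2` on the left side suffices.
  · have h1 : 1 ≤ x ^ 4 := by
      have := one_le_pow₀ hx (n := 4)
      rwa [show |x| ^ 4 = x ^ 4 from by rw [← abs_pow, abs_of_nonneg (by positivity)]] at this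
    have h2 : Real.exp (-(x ^ 2 / 2)) ≤ 1 := Real.exp_le_one_iff.2 (by linarith [sq_nonneg x])
    have h3 := Real.exp_pos (-(x ^ 2 / 2))
    rw [abs_le]
    constructor <;> linarith [Real.cos_le_one x, Real.neg_one_le_cos x]

lemma abs_prod_le_exp_neg_sum {ι : Type*} (s : Finset ι) {a c : ι → ℝ}
    (ha : ∀ i ∈ s, |a i| ≤ Real.exp (-c i)) : |∏ i ∈ s, a i| ≤ Real.exp (-∑ i ∈ s, c i) := by
  rw [Finset.abs_prod, ← Finset.sum_neg_distrib, Real.exp_sum]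
  exact Finset.prod_le_prod (fun _ _ => abs_nonneg _) ha

/-- A telescoping bound for the difference of two products with exponentially small factors. -/
lemma abs_prod_sub_prod_le {ι : Type*} (s : Finset ι) {a b c d : ι → ℝ} {M : ℝ}
    (ha : ∀ i ∈ s, |a i| ≤ Real.exp (-c i)) (hb : ∀ i ∈ s, |b i| ≤ Real.exp (-c i))
    (hc : ∀ i ∈ s, c i ≤ M) (hd : ∀ i ∈ s, |a i - b i| ≤ d i) :
    |∏ i ∈ s, a i - ∏ i ∈ s, b i| ≤
      Real.exp M * (∑ i ∈ s, d i) * Real.exp (-∑ i ∈ s, c i) := by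
  classical
  induction s using Finset.induction_on with
  | empty => simp
  | insert i s hi ih =>
    simp only [Finset.forall_mem_insert] at ha hb hc hd
    have ih := ih ha.2 hb.2 hc.2 hd.2
    have hB := abs_prod_le_exp_neg_sum s hb.2
    rw [Finset.prod_insert hi, Finset.prod_insert hi, Finset.sum_insert hi, Finset.sum_insert hi]
    set A := ∏ i ∈ s, a i
    set B := ∏ i ∈ s, b i
    set E := Real.exp (-∑ i ∈ s, c i) with hE
    have hd0 : 0 ≤ d i := (abs_nonneg _).trans hd.1
    -- The term `d i` lacks its factor `exp(-c i)`; restoring it costs at most `exp M`.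
    have h1 : 1 ≤ Real.exp M * Real.exp (-c i) := by
      rw [← Real.exp_add]; exact Real.one_le_exp (by linarith [hc.1])
    calc |a i * A - b i * B| = |a i * (A - B) + (a i - b i) * B| := by ring_nf
      _ ≤ |a i| * |A - B| + |a i - b i| * |B| := by
        rw [← abs_mul, ← abs_mul]; exact abs_add_le _ _
      _ ≤ Real.exp (-c i) * (Real.exp M * (∑ i ∈ s, d i) * E) + d i * E := by
        gcongr
        · exact ha.1
        · exact hd.1
      _ ≤ Real.exp (-c i) * (Real.exp M * (∑ i ∈ s, d i) * E) +
          (Real.exp M * Real.exp (-c i)) * (d i * E) := by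
        refine add_le_add le_rfl ?_
        exact le_mul_of_one_le_left (mul_nonneg hd0 (Real.exp_pos _).le) h1
      _ = _ := by rw [neg_add, Real.exp_add]; ring

section CharacteristicBounds

variable {ι : Type*} {a : ι → ℝ} {s ξ : ℝ}

/-- The exponent contributed by the `i`-th coordinate: only coordinates below `s` count. -/
noncomputable def truncatedExponent (a : ι → ℝ) (s ξ : ℝ) (i : ι) : ℝ :=
  if s ≤ |a i| then 0 else (a i * ξ) ^ 2 / 4

lemma abs_mul_le_one_of_lt (hsξ : s * |ξ| ≤ 1) {i : ι} (hi : ¬ s ≤ |a i|) : |a i * ξ| ≤ 1 := by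
  rw [abs_mul]
  exact (mul_le_mul_of_nonneg_right (not_le.1 hi).le (abs_nonneg _)).trans hsξ

lemma abs_cos_le_exp_neg_truncatedExponent (hsξ : s * |ξ| ≤ 1) (i : ι) :
    |Real.cos (a i * ξ)| ≤ Real.exp (-truncatedExponent a s ξ i) := by
  by_cases hi : s ≤ |a i|
  · simpa [truncatedExponent, hi] using Real.abs_cos_le_one _
  · simpa [truncatedExponent, hi] using abs_cos_le_exp_neg_sq (abs_mul_le_one_of_lt hsξ hi)

variable [Fintype ι]

lemma le_sum_truncatedExponent (ha : ∑ i, a i ^ 2 = 1)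
    (hs : ∑ i with s ≤ |a i|, a i ^ 2 ≤ 1 / 2) (ξ : ℝ) :
    ξ ^ 2 / 8 ≤ ∑ i, truncatedExponent a s ξ i := by
  have h := Finset.sum_filter_add_sum_filter_not Finset.univ (fun i => s ≤ |a i|)
    (fun i => a i ^ 2)
  have e : ∑ i, truncatedExponent a s ξ i =
      (∑ i with ¬ s ≤ |a i|, a i ^ 2) * (ξ ^ 2 / 4) := by
    rw [Finset.sum_mul, Finset.sum_filter]
    refine Finset.sum_congr rfl fun i _ => ?_
    by_cases hi : s ≤ |a i| <;> simp [truncatedExponent, hi]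
    ring
  rw [e]
  nlinarith [sq_nonneg ξ]

lemma abs_prod_cos_le (ha : ∑ i, a i ^ 2 = 1)
    (hs : ∑ i with s ≤ |a i|, a i ^ 2 ≤ 1 / 2) (hsξ : s * |ξ| ≤ 1) :
    |∏ i, Real.cos (a i * ξ)| ≤ Real.exp (-(ξ ^ 2 / 8)) :=
  (abs_prod_le_exp_neg_sum _ fun i _ => abs_cos_le_exp_neg_truncatedExponent hsξ i).trans
    (Real.exp_le_exp.2 (neg_le_neg (le_sum_truncatedExponent ha hs ξ)))

lemma abs_prod_cos_sub_exp_le (ha : ∑ i, a i ^ 2 = 1)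
    (hs : ∑ i with s ≤ |a i|, a i ^ 2 ≤ 1 / 2) (hsξ : s * |ξ| ≤ 1) :
    |∏ i, Real.cos (a i * ξ) - Real.exp (-(ξ ^ 2 / 2))| ≤
      2 * Real.exp 1 * (∑ i, a i ^ 4) * ξ ^ 4 * Real.exp (-(ξ ^ 2 / 8)) := by
  have e : Real.exp (-(ξ ^ 2 / 2)) = ∏ i, Real.exp (-((a i * ξ) ^ 2 / 2)) := by
    rw [← Real.exp_sum, Finset.sum_neg_distrib]
    congr 2
    simp_rw [mul_pow, mul_div_assoc]
    rw [← Finset.sum_mul, ha, one_mul]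
  rw [e]
  -- Each truncated exponent is at most `1/4`, so `M = 1` is ample.
  have h := abs_prod_sub_prod_le Finset.univ (a := fun i => Real.cos (a i * ξ))
    (b := fun i => Real.exp (-((a i * ξ) ^ 2 / 2))) (c := truncatedExponent a s ξ)
    (d := fun i => 2 * (a i * ξ) ^ 4) (M := 1)
    (fun i _ => abs_cos_le_exp_neg_truncatedExponent hsξ i)
    (fun i _ => by
      rw [abs_of_pos (Real.exp_pos _), Real.exp_le_exp]
      unfold truncatedExponent
      split_ifs <;> linarith [sq_nonneg (a i * ξ)])
    (fun i _ => by
      unfold truncatedExponent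
      split_ifs with hi
      · exact zero_le_one
      · have := abs_mul_le_one_of_lt hsξ hi
        have : (a i * ξ) ^ 2 ≤ 1 := by rw [← sq_abs]; exact pow_le_one₀ (abs_nonneg _) this
        linarith)
    (fun i _ => abs_cos_sub_exp_le _)
  refine h.trans ?_
  have e2 : ∑ i, 2 * (a i * ξ) ^ 4 = 2 * (∑ i, a i ^ 4) * ξ ^ 4 := by
    simp_rw [mul_pow]
    rw [← Finset.mul_sum, ← Finset.sum_mul]; ring
  have h0 : 0 ≤ ∑ i, a i ^ 4 := Finset.sum_nonneg fun i _ => by positivity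
  rw [e2]
  calc _ ≤ Real.exp 1 * (2 * (∑ i, a i ^ 4) * ξ ^ 4) * Real.exp (-(ξ ^ 2 / 8)) := by
        gcongr
        exact le_sum_truncatedExponent ha hs ξ
    _ = _ := by ring

/-- The smoothed Rademacher characteristic function is close to the Gaussian one at all
frequencies. -/
lemma abs_mul_prod_cos_sub_exp_le {γ : ℝ → ℝ} (hγ0 : ∀ ξ, 1 ≤ |ξ| → γ ξ = 0)
    (hγ : ∀ ξ, |γ ξ - 1| ≤ 1000 * ξ ^ 2) (hs0 : 0 < s) (ha : ∑ i, a i ^ 2 = 1)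
    (hs : ∑ i with s ≤ |a i|, a i ^ 2 ≤ 1 / 2) (ξ : ℝ) :
    |γ (s * ξ) * ∏ i, Real.cos (a i * ξ) - Real.exp (-(ξ ^ 2 / 2))| ≤
      1000 * (s ^ 2 + ∑ i, a i ^ 4) * (ξ ^ 2 + ξ ^ 4) * Real.exp (-(ξ ^ 2 / 8)) := by
  have h0 : 0 ≤ ∑ i, a i ^ 4 := Finset.sum_nonneg fun i _ => by positivity
  set S := ∑ i, a i ^ 4
  set E := Real.exp (-(ξ ^ 2 / 8)) with hE
  have hE0 : 0 < E := Real.exp_pos _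
  rcases le_or_gt 1 (|s * ξ|) with h | h
  · rw [hγ0 _ h, zero_mul, zero_sub, abs_neg, abs_of_pos (Real.exp_pos _)]
    have h1 : 1 ≤ s ^ 2 * ξ ^ 2 := by
      rw [← mul_pow, ← sq_abs]; exact one_le_pow₀ h
    have h2 : Real.exp (-(ξ ^ 2 / 2)) ≤ E := Real.exp_le_exp.2 (by linarith [sq_nonneg ξ])
    refine h2.trans (le_mul_of_one_le_left hE0.le ?_)
    have : 0 ≤ s ^ 2 * ξ ^ 4 + S * (ξ ^ 2 + ξ ^ 4) := by positivity
    nlinarith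
  · have hsξ : s * |ξ| ≤ 1 := by rw [abs_mul, abs_of_pos hs0] at h; exact h.le
    have h1 := abs_prod_cos_le ha hs hsξ
    have h2 := abs_prod_cos_sub_exp_le ha hs hsξ
    set p := ∏ i, Real.cos (a i * ξ)
    have he : Real.exp 1 ≤ 3 := by linarith [Real.exp_one_lt_d9]
    calc _ = |(γ (s * ξ) - 1) * p + (p - Real.exp (-(ξ ^ 2 / 2)))| := by ring_nf
      _ ≤ |γ (s * ξ) - 1| * |p| + |p - Real.exp (-(ξ ^ 2 / 2))| := by
        rw [← abs_mul]; exact abs_add_le _ _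
      _ ≤ 1000 * (s * ξ) ^ 2 * E + 2 * 3 * S * ξ ^ 4 * E := by
        gcongr
        · exact hγ _
        · exact h2.trans (by gcongr)
      _ ≤ _ := by
        -- The slack between the two sides; `994 = 1000 - 2 * 3`.
        have : 0 ≤ (1000 * s ^ 2 * ξ ^ 4 + 1000 * S * ξ ^ 2 + 994 * S * ξ ^ 4) * E := by
          positivity
        linarith

end CharacteristicBounds

/-! ### Laws and characteristic functions of the variables. -/

lemma gaussTail_eq_gaussianReal (t : ℝ) : gaussTail t = (gaussianReal 0 1).real (Set.Ici t) := by
  have h0 : ∀ᵐ x ∂(volume.restrict (Set.Ici t)), 0 ≤ gaussianPDFReal 0 1 x :=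
    .of_forall fun x => gaussianPDFReal_nonneg 0 1 x
  rw [Measure.real, gaussianReal_apply_eq_integral 0 one_ne_zero,
    ENNReal.toReal_ofReal (integral_nonneg_of_ae h0), gaussTail, integral_Ici_eq_integral_Ioi]
  congr 1 with x
  simp [gaussDensity, gaussianPDFReal]

lemma charFun_gaussianReal_zero_one (ξ : ℝ) :
    charFun (gaussianReal 0 1) ξ = (Real.exp (-(ξ ^ 2 / 2)) : ℂ) := by
  rw [charFun_gaussianReal]
  push_cast
  congr 1
  simp

section Variables

variable {Ω : Type*} [MeasurableSpace Ω] {P : Measure Ω}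

lemma fourierOf_eq_charFun {Γ : Ω → ℝ} (hΓ : Measurable Γ) (ξ : ℝ) :
    fourierOf P Γ ξ = charFun (P.map Γ) (-ξ) := by
  rw [charFun_apply_real, integral_map hΓ.aemeasurable (by fun_prop), fourierOf]
  congr 1 with ω
  congr 1
  push_cast
  ring

/-- Symmetry makes the characteristic function even, and evenness with conjugate symmetry makes it
real. -/
lemma charFun_map_eq_re_fourierOf {Γ : Ω → ℝ} (hΓ : Measurable Γ)
    (hsymm : IdentDistrib Γ (fun ω => -Γ ω) P P) (ξ : ℝ) :
    charFun (P.map Γ) ξ = ((fourierOf P Γ ξ).re : ℂ) := by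
  have h : charFun (P.map Γ) (-ξ) = charFun (P.map Γ) ξ := by
    conv_rhs => rw [hsymm.map_eq]
    have := charFun_map_mul_comp (μ := P) hΓ.aemeasurable (-1) ξ
    simpa using this.symm
  rw [fourierOf_eq_charFun hΓ, h]
  rw [charFun_neg] at h
  exact (Complex.conj_eq_iff_re.1 h).symm

/-- Inversion needs a first moment, which follows from `|x| ≤ 1 + x⁶`. -/
lemma IsSmoothingVariable.integrable [IsFiniteMeasure P] {Γ : Ω → ℝ}
    (h : IsSmoothingVariable P Γ) : Integrable Γ P := by
  refine ((integrable_const (1 : ℝ)).add h.integrable_pow_six).mono'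
    h.measurable.aestronglyMeasurable (.of_forall fun ω => ?_)
  have e : Γ ω ^ 6 = |Γ ω| ^ 6 := by rw [← abs_pow, abs_of_nonneg (by positivity)]
  simp only [Pi.add_apply, Real.norm_eq_abs, e]
  rcases le_total |Γ ω| 1 with h1 | h1
  · linarith [pow_nonneg (abs_nonneg (Γ ω)) 6]
  · linarith [le_self_pow₀ h1 (n := 6) (by norm_num)]

lemma IsSymmetricBernoulli.ae_eq_or [IsProbabilityMeasure P] {D : Ω → ℝ}
    (h : IsSymmetricBernoulli P D) : ∀ᵐ ω ∂P, D ω = 1 ∨ D ω = -1 := by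
  have h1 : MeasurableSet {ω | D ω = 1} := h.measurable (measurableSet_singleton 1)
  have h2 : MeasurableSet {ω | D ω = -1} := h.measurable (measurableSet_singleton (-1))
  have hd : Disjoint {ω | D ω = 1} {ω | D ω = -1} := by
    rw [Set.disjoint_left]
    intro ω (h1 : D ω = 1) (h2 : D ω = -1)
    linarith
  have hu : P ({ω | D ω = 1} ∪ {ω | D ω = -1}) = 1 := by
    rw [measure_union hd h2, h.prob_one, h.prob_neg_one]
    exact ENNReal.add_halves 1
  exact (prob_compl_eq_zero_iff (h1.union h2)).2 hu

lemma IsSymmetricBernoulli.integrable [IsProbabilityMeasure P] {D : Ω → ℝ}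
    (h : IsSymmetricBernoulli P D) : Integrable D P :=
  Integrable.of_bound h.measurable.aestronglyMeasurable 1
    (h.ae_eq_or.mono fun ω hω => by rcases hω with h | h <;> simp [h])

lemma IsSymmetricBernoulli.charFun_map [IsProbabilityMeasure P] {D : Ω → ℝ}
    (h : IsSymmetricBernoulli P D) (ξ : ℝ) : charFun (P.map D) ξ = (Real.cos ξ : ℂ) := by
  have h1 : MeasurableSet {ω | D ω = 1} := h.measurable (measurableSet_singleton 1)
  have h2 : MeasurableSet {ω | D ω = -1} := h.measurable (measurableSet_singleton (-1))
  rw [charFun_apply_real, integral_map h.measurable.aemeasurable (by fun_prop)]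
  have hae : (fun ω => Complex.exp (ξ * D ω * Complex.I)) =ᵐ[P] fun ω =>
      {ω | D ω = 1}.indicator (fun _ => Complex.exp (ξ * Complex.I)) ω +
        {ω | D ω = -1}.indicator (fun _ => Complex.exp (-ξ * Complex.I)) ω := by
    filter_upwards [h.ae_eq_or] with ω hω
    rcases hω with hω | hω <;> simp [hω, Set.indicator_apply] <;> norm_num
  rw [integral_congr_ae hae, integral_add ((integrable_const _).indicator h1)
    ((integrable_const _).indicator h2), integral_indicator_const _ h1,
    integral_indicator_const _ h2]
  simp only [Measure.real, h.prob_one, h.prob_neg_one]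
  push_cast
  rw [Complex.cos]
  simp
  ring

variable [IsProbabilityMeasure P] {ι : Type*} [Fintype ι] {Γ : Ω → ℝ} {D : ι → Ω → ℝ}

lemma charFun_map_smoothed_sum (hΓ : IsSmoothingVariable P Γ)
    (hD : ∀ i, IsSymmetricBernoulli P (D i)) (hind : iIndepFun D P)
    (hΓD : IndepFun Γ (fun ω i => D i ω) P) (a : ι → ℝ) (s ξ : ℝ) :
    charFun (P.map fun ω => s * Γ ω + ∑ i, a i * D i ω) ξ =
      (((fourierOf P Γ (s * ξ)).re * ∏ i, Real.cos (a i * ξ) : ℝ) : ℂ) := by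
  have hm (i : ι) : Measurable fun ω => a i * D i ω := (hD i).measurable.const_mul _
  have h1 : IndepFun (fun ω => s * Γ ω) (fun ω => ∑ i, a i * D i ω) P :=
    hΓD.comp (φ := fun x => s * x) (ψ := fun v : ι → ℝ => ∑ i, a i * v i) (by fun_prop)
      (by fun_prop)
  have h2 : iIndepFun (fun i ω => a i * D i ω) P :=
    hind.comp (fun i x => a i * x) (fun i => by fun_prop)
  have h3 := h1.charFun_map_add_eq_mul (hΓ.measurable.const_mul s).aemeasurable
    (Finset.measurable_sum _ fun i _ => hm i).aemeasurable
  have h4 := h2.charFun_map_fun_sum_eq_prod fun i => (hm i).aemeasurable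
  change charFun (P.map ((fun ω => s * Γ ω) + fun ω => ∑ i, a i * D i ω)) ξ = _
  rw [h3, h4, Pi.mul_apply, Finset.prod_apply, charFun_map_mul_comp hΓ.measurable.aemeasurable,
    charFun_map_eq_re_fourierOf hΓ.measurable hΓ.symmetric]
  push_cast
  congr 1
  refine Finset.prod_congr rfl fun i _ => ?_
  rw [charFun_map_mul_comp (hD i).measurable.aemeasurable, (hD i).charFun_map]
  push_cast
  rfl

/-- The normalised majorant of the difference of characteristic functions over the frequency. -/
noncomputable def frequencyMajorant (ξ : ℝ) : ℝ :=
  (|ξ| + |ξ| ^ 3) * Real.exp (-(ξ ^ 2 / 8))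

lemma integrable_frequencyMajorant : Integrable frequencyMajorant := by
  have h (m : ℕ) : Integrable fun ξ : ℝ => |ξ| ^ m * Real.exp (-(ξ ^ 2 / 8)) := by
    have h := (integrable_rpow_mul_exp_neg_mul_sq (b := 1 / 8) (by norm_num) (s := (m : ℝ))
      (by linarith [m.cast_nonneg (α := ℝ)])).norm
    refine h.congr (.of_forall fun ξ => ?_)
    simp only [Real.rpow_natCast, norm_mul, norm_pow, Real.norm_eq_abs, Real.abs_exp]
    congr 2
    ring
  refine ((h 1).add (h 3)).congr (.of_forall fun ξ => ?_)
  simp only [Pi.add_apply, frequencyMajorant]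
  ring

lemma abs_measureReal_sub_gaussTail_le (hΓ : IsSmoothingVariable P Γ)
    (hD : ∀ i, IsSymmetricBernoulli P (D i)) (hind : iIndepFun D P)
    (hΓD : IndepFun Γ (fun ω i => D i ω) P) {a : ι → ℝ} {s : ℝ} (hs0 : 0 < s)
    (ha : ∑ i, a i ^ 2 = 1) (hs : ∑ i with s ≤ |a i|, a i ^ 2 ≤ 1 / 2) (t : ℝ) :
    |P.real {ω | t ≤ s * Γ ω + ∑ i, a i * D i ω} - gaussTail t| ≤
      (2 * Real.pi)⁻¹ * 1000 * (∫ ξ, frequencyMajorant ξ) * (s ^ 2 + ∑ i, a i ^ 4) := by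
  have hX : Integrable (fun ω => s * Γ ω + ∑ i, a i * D i ω) P :=
    (hΓ.integrable.const_mul s).add
      (integrable_finsetSum _ fun i _ => (hD i).integrable.const_mul (a i))
  have hXm : Measurable fun ω => s * Γ ω + ∑ i, a i * D i ω :=
    (hΓ.measurable.const_mul s).add
      (Finset.measurable_sum _ fun i _ => (hD i).measurable.const_mul (a i))
  set X : Ω → ℝ := fun ω => s * Γ ω + ∑ i, a i * D i ω with hXdef
  have : IsProbabilityMeasure (P.map X) := Measure.isProbabilityMeasure_map hXm.aemeasurable
  have hXi : Integrable (fun y => y) (P.map X) :=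
    (integrable_map_measure (by fun_prop) hXm.aemeasurable).2 hX
  have hGi : Integrable (fun y => y) (gaussianReal 0 1) :=
    memLp_one_iff_integrable.1 (memLp_id_gaussianReal' 1 ENNReal.one_ne_top)
  have hbound (ξ : ℝ) : ‖charFun (P.map X) ξ - charFun (gaussianReal 0 1) ξ‖ ≤
      |ξ| * (1000 * (s ^ 2 + ∑ i, a i ^ 4) * frequencyMajorant ξ) := by
    rw [hXdef, charFun_map_smoothed_sum hΓ hD hind hΓD, charFun_gaussianReal_zero_one,
      ← Complex.ofReal_sub, Complex.norm_real, Real.norm_eq_abs]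
    refine (abs_mul_prod_cos_sub_exp_le (γ := fun ξ => (fourierOf P Γ ξ).re)
      (fun ξ hξ => by simp [hΓ.fourier_eq_zero ξ hξ])
      (fun ξ => abs_le.2 ⟨by linarith [hΓ.le_fourier ξ], by
        linarith [hΓ.fourier_le ξ, sq_nonneg ξ]⟩) hs0 ha hs ξ).trans_eq ?_
    have e2 : ξ ^ 2 = |ξ| ^ 2 := (sq_abs ξ).symm
    have e4 : ξ ^ 4 = |ξ| ^ 4 := by rw [← abs_pow, abs_of_nonneg (by positivity)]
    rw [frequencyMajorant, e4, e2]
    ring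
  have h := abs_measureReal_Ici_sub_le hXi hGi (integrable_frequencyMajorant.const_mul _) hbound t
  rw [integral_const_mul, map_measureReal_apply hXm measurableSet_Ici,
    ← gaussTail_eq_gaussianReal] at h
  refine h.trans_eq ?_
  ring

end Variables

/-! ### Reduction to unit norm. -/

theorem lemma6p1 :
    ∃ C : ℝ, 0 < C ∧
      ∀ (Ω : Type*) [MeasurableSpace Ω] (P : Measure Ω) [IsProbabilityMeasure P]
        (n : ℕ) (Γ : Ω → ℝ) (Δ : Fin n → Ω → ℝ),
        IsSmoothingVariable P Γ →
        (∀ i, IsSymmetricBernoulli P (Δ i)) →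
        iIndepFun Δ P →
        IndepFun Γ (fun ω i => Δ i ω) P →
        ∀ (θ : EuclideanSpace ℝ (Fin n)) (σ : ℝ), θ ≠ 0 → 0 < σ →
          (∑ i with σ ≤ |θ i|, θ i ^ 2) ≤ 1 / 2 * ‖θ‖ ^ 2 →
          ∀ t : ℝ,
            |P.real {ω | t ≤ σ * Γ ω + ∑ i, θ i * Δ i ω} - gaussTail (t / ‖θ‖)| ≤
              C * (σ ^ 2 / ‖θ‖ ^ 2 + ∑ i, θ i ^ 4 / ‖θ‖ ^ 4) := by
  have hI : 0 ≤ ∫ ξ, frequencyMajorant ξ :=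
    integral_nonneg fun ξ => by unfold frequencyMajorant; positivity
  -- The `+ 1` gives positivity from mere nonnegativity of the integral.
  refine ⟨(2 * Real.pi)⁻¹ * 1000 * (∫ ξ, frequencyMajorant ξ) + 1, by positivity, ?_⟩
  intro Ω _ P _ n Γ Δ hΓ hΔ hind hΓΔ θ σ hθ hσ hsmall t
  have hr : 0 < ‖θ‖ := norm_pos_iff.2 hθ
  have hnorm : ∑ i, θ i ^ 2 = ‖θ‖ ^ 2 := by
    simp [EuclideanSpace.norm_sq_eq]
  have ha : ∑ i, (θ i / ‖θ‖) ^ 2 = 1 := by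
    simp_rw [div_pow]
    rw [← Finset.sum_div, hnorm, div_self (by positivity)]
  have hs : ∑ i with σ / ‖θ‖ ≤ |θ i / ‖θ‖|, (θ i / ‖θ‖) ^ 2 ≤ 1 / 2 := by
    simp_rw [abs_div, abs_norm, div_le_div_iff_of_pos_right hr, div_pow]
    rw [← Finset.sum_div, div_le_iff₀ (by positivity)]
    exact hsmall
  have h := abs_measureReal_sub_gaussTail_le hΓ hΔ hind hΓΔ (div_pos hσ hr) ha hs (t / ‖θ‖)
  have hset : {ω | t / ‖θ‖ ≤ σ / ‖θ‖ * Γ ω + ∑ i, θ i / ‖θ‖ * Δ i ω} =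
      {ω | t ≤ σ * Γ ω + ∑ i, θ i * Δ i ω} := by
    ext ω
    have e : σ / ‖θ‖ * Γ ω + ∑ i, θ i / ‖θ‖ * Δ i ω =
        (σ * Γ ω + ∑ i, θ i * Δ i ω) / ‖θ‖ := by
      rw [add_div, Finset.sum_div]
      congr 1
      · ring
      · exact Finset.sum_congr rfl fun i _ => by ring
    simp only [Set.mem_ofPred_eq, e, div_le_div_iff_of_pos_right hr]
  rw [hset] at h
  simp_rw [div_pow] at h
  refine h.trans (mul_le_mul_of_nonneg_right (by linarith) ?_)
  exact add_nonneg (by positivity) (Finset.sum_nonneg fun i _ => by positivity)
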